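/- Let $G$ be a finite undirected graph (parallel edges and loops are allowed), with vertex set $\tilde V$, edge set $E$ and two disjoint sets $S,T\subseteq\tilde V$ (inputs and outputs) of vertices of degree $1$; put $V=\tilde V\setminus(S\cup T)$. Let $c:E\to\{1,2,3,\dots\}$ be a capacity function, and attach to each edge $e$ the space $\mathbb C^{c_e}$ with its standard basis. For $u\in S\cup T$ let $e(u)$ be the edge at $u$. A tensor assignment $\mathcal T$ chooses for every $v\in V$ a tensor $\mathcal T_v\in\bigotimes_{h}\mathbb C^{c_{e(h)}}$, where $h$ runs over the ends of edges at $v$ (a loop has two ends at its vertex) and $e(h)$ is the edge of $h$. Contracting the network gives the linear map $$\beta(G,c;\mathcal T):\bigotimes_{u\in S}\mathbb C^{c_{e(u)}}\to\bigotimes_{u\in T}\mathbb C^{c_{e(u)}},\qquad \langle I_T|\beta(G,c;\mathcal T)|I_S\rangle=\sum_{W}\ \prod_{v\in V}\langle W|_v\,|\,\mathcal T_v\rangle,$$ where $W$ runs over all assignments of a basis index to each edge of $G$ that restrict to $I_S$ on the inputs and to $I_T$ on the outputs, and $W|_v$ is the list of the indices that $W$ gives to the edge ends at $v$. Let $\operatorname{QMF}(G,c)$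 be the maximum of $\operatorname{rank}\beta(G,c;\mathcal T)$ over all tensor assignments $\mathcal T$. An edge cut set is the set of all edges joining $\bar S$ to $\bar T$ for some partition $\tilde V=\bar S\sqcup\bar T$ with $S\subseteq\bar S$ and $T\subseteq\bar T$. Let $C$ be the minimum cardinality of an edge cut set (the classical min cut). If $d_{\min}$ is a natural number with $c_e\ge d_{\min}$ for every edge $e$, then $$\operatorname{QMF}(G,c)\ \ge\ d_{\min}^{\,C}.$$ -/

import Mathlib

/-- The ends of edges of the multigraph `G` that lie at the vertex `v`: one for each edge incident
to `v`, and a second one for each loop at `v`. -/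
def EdgeEnd {α β : Type*} (G : Graph α β) (v : α) : Type _ :=
  G.incidenceSet v ⊕ G.loopSet v

namespace EdgeEnd

variable {α β : Type*} {G : Graph α β} {v : α}

/-- The edge to which an end belongs. -/
def edge : EdgeEnd G v → G.edgeSet
  | .inl e => ⟨e.1, Graph.Inc.edge_mem e.2⟩
  | .inr e => ⟨e.1, Graph.IsLoopAt.edge_mem e.2⟩

instance [Finite G.edgeSet] : Finite (EdgeEnd G v) :=
  haveI : Finite (G.incidenceSet v) :=
    Set.Finite.subset (Set.toFinite G.edgeSet) (G.incidenceSet_subset_edgeSet v)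
  haveI : Finite (G.loopSet v) :=
    Set.Finite.subset (Set.toFinite (G.incidenceSet v)) (G.loopSet_subset_incidenceSet v)
  inferInstanceAs (Finite (G.incidenceSet v ⊕ G.loopSet v))

end EdgeEnd

/-- A finite undirected multigraph with two disjoint sets `S` (inputs) and `T` (outputs) of
vertices of degree one, the open ends of the graph. The vertices outside `S ∪ T` are the ones that
will carry tensors. -/
structure OpenGraph (α β : Type*) where
  /-- the underlying undirected multigraph -/
  graph : Graph α β
  /-- the inputs -/
  S : Set α
  /-- the outputs -/
  T : Set α
  finite_vertexSet : graph.vertexSet.Finite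
  finite_edgeSet : graph.edgeSet.Finite
  subset_left : S ⊆ graph.vertexSet
  subset_right : T ⊆ graph.vertexSet
  disjoint : Disjoint S T
  /-- inputs and outputs have degree one (a loop counts twice) -/
  degree_eq_one : ∀ u ∈ S ∪ T, Nat.card (EdgeEnd graph u) = 1

namespace OpenGraph

variable {α β : Type*} (N : OpenGraph α β)

/-- The vertices that are not open ends. -/
def internal : Set α := N.graph.vertexSet \ (N.S ∪ N.T)

noncomputable instance : Fintype N.graph.edgeSet := N.finite_edgeSet.fintype

noncomputable instance : Fintype N.S := (N.finite_vertexSet.subset N.subset_left).fintype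

noncomputable instance : Fintype N.T := (N.finite_vertexSet.subset N.subset_right).fintype

noncomputable instance : Fintype N.internal :=
  (N.finite_vertexSet.subset Set.sdiff_subset).fintype

/-! ### Cuts -/

/-- `C` is the set of edges between the two sides of a partition of the vertex set, with all inputs
on one side and all outputs on the other. -/
def IsEdgeCut (C : Set β) : Prop :=
  ∃ A B : Set α, A ∪ B = N.graph.vertexSet ∧ Disjoint A B ∧ N.S ⊆ A ∧ N.T ⊆ B ∧
    C = {e | ∃ u ∈ A, ∃ v ∈ B, N.graph.IsLink e u v}

/-- The classical min cut: the least cardinality of an edge cut set. -/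
noncomputable def minCut : ℕ :=
  sInf {n | ∃ C : Set β, N.IsEdgeCut C ∧ C.ncard = n}

/-- Edge cut sets exist, hence the minimum in `minCut` is attained. -/
theorem exists_isEdgeCut_ncard_eq_minCut : ∃ C : Set β, N.IsEdgeCut C ∧ C.ncard = N.minCut := by
  have h : {n | ∃ C : Set β, N.IsEdgeCut C ∧ C.ncard = n}.Nonempty := by
    refine ⟨_, _, ⟨N.S, N.graph.vertexSet \ N.S, Set.union_sdiff_cancel N.subset_left,
      Set.disjoint_sdiff_right, subset_rfl, ?_, rfl⟩, rfl⟩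
    exact fun x hx => ⟨N.subset_right hx, fun hS => Set.disjoint_left.1 N.disjoint hS hx⟩
  exact Nat.sInf_mem h

/-! ### Tensor networks; an edge `e` carries the space `ℂ ^ (c e)` with its standard basis -/

variable (c : β → ℕ)

/-- Multi-indices for all edges: a basis index for each edge. -/
abbrev EdgeIndex : Type _ := (e : N.graph.edgeSet) → Fin (c e)

/-- Multi-indices at `v`: a basis index for each edge end at `v`. They index the standard basis of
the tensor product of the spaces `ℂ ^ (c e)` over the edge ends at `v`. -/
abbrev LocalIndex (v : α) : Type _ := (h : EdgeEnd N.graph v) → Fin (c h.edge)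

/-- The portion of a multi-index for all edges that can be read at `v`. -/
def readAt {N : OpenGraph α β} {c : β → ℕ} (W : N.EdgeIndex c) (v : α) : N.LocalIndex c v :=
  fun h => W h.edge

/-- Multi-indices for the input edges. An input has just one edge end, so this indexes the standard
basis of the tensor product over `u ∈ S` of the spaces `ℂ ^ (c e(u))`, `e(u)` the edge at `u`. -/
abbrev InputIndex : Type _ := (u : N.S) → N.LocalIndex c u

/-- Multi-indices for the output edges. -/
abbrev OutputIndex : Type _ := (u : N.T) → N.LocalIndex c u

noncomputable instance : Fintype (N.EdgeIndex c) := Fintype.ofFinite _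

noncomputable instance (v : α) : Fintype (N.LocalIndex c v) := Fintype.ofFinite _

noncomputable instance : Fintype (N.InputIndex c) := Fintype.ofFinite _

noncomputable instance : Fintype (N.OutputIndex c) := Fintype.ofFinite _

/-- An assignment of a tensor, given by its coordinates in the standard basis, to each vertex that
is not an open end. -/
abbrev TensorAssignment : Type _ := (v : N.internal) → N.LocalIndex c v → ℂ

variable {c} in
open Classical in
/-- The matrix, in the standard bases, of the linear map from the input space to the output space
that is obtained by contracting the tensor network. -/
noncomputable def beta (𝒯 : N.TensorAssignment c) :
    Matrix (N.OutputIndex c) (N.InputIndex c) ℂ :=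
  fun J I => ∑ W : N.EdgeIndex c with
    (∀ u : N.S, readAt W (u : α) = I u) ∧ (∀ u : N.T, readAt W (u : α) = J u),
      ∏ v : N.internal, 𝒯 v (readAt W (v : α))

/-- The quantum max-flow: the maximal rank of `beta` over all tensor assignments. -/
noncomputable def quantumMaxFlow : ℕ :=
  sSup (Set.range fun 𝒯 : N.TensorAssignment c => (N.beta 𝒯).rank)

/-- The ranks are bounded and tensor assignments exist, hence the maximum is attained. -/
theorem exists_rank_beta_eq_quantumMaxFlow :
    ∃ 𝒯 : N.TensorAssignment c, (N.beta 𝒯).rank = N.quantumMaxFlow c := by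
  have h := Nat.sSup_mem (s := Set.range fun 𝒯 : N.TensorAssignment c => (N.beta 𝒯).rank)
    ⟨_, fun _ _ => 0, rfl⟩ ⟨Fintype.card (N.InputIndex c), by
      rintro _ ⟨𝒯, rfl⟩
      exact (N.beta 𝒯).rank_le_card_width⟩
  exact h

end OpenGraph

/-!
Menger's theorem, applied to the edges of the graph, gives `C` disjoint walks from the inputs to the
outputs. Label each of these walks by a number below `d`, and let every vertex carry the indicator
tensor of the local restrictions of the `d ^ C` labellings. A multi-index that survives in the
contraction need not be one of the labellings, but being locally constant along each of the walks it
transports all labels from the inputs to the outputs. Hence the labellings pick out a submatrix of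
the contraction that is diagonal with nonzero diagonal entries, which has rank `d ^ C`.

Menger's theorem is proved by Göring's induction on the number of arcs. If deleting an arc
`(x, y)` creates a separator `Z` with fewer than `n` vertices, then `Z ∪ {x}` and `Z ∪ {y}` have
exactly `n`, and `n` disjoint walks up to `Z ∪ {x}` are glued to `n` disjoint walks from `Z ∪ {y}`
along `Z` and the arc.
-/

/-! ### Menger's theorem -/

section Menger

open Function

variable {X : Type*} {R R' : SetRel X X} {F F' A B P Q H K Y Z : Set X} {a b p q u v x y z : X}
  {n : ℕ}

/-- `WalkIn R F a b`: the digraph `R` has a walk from `a` to `b` all of whose vertices, including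
`a` and `b`, lie in `F`. -/
inductive WalkIn (R : SetRel X X) (F : Set X) (a : X) : X → Prop
  | refl : a ∈ F → WalkIn R F a a
  | tail {b z : X} : WalkIn R F a b → (b, z) ∈ R → z ∈ F → WalkIn R F a z

namespace WalkIn

theorem right_mem (h : WalkIn R F a b) : b ∈ F := by
  cases h <;> assumption

theorem left_mem (h : WalkIn R F a b) : a ∈ F := by
  induction h with
  | refl ha => exact ha
  | tail _ _ _ ih => exact ih

theorem mono (hR : R ⊆ R') (hF : F ⊆ F') (h : WalkIn R F a b) : WalkIn R' F' a b := by
  induction h with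
  | refl ha => exact .refl (hF ha)
  | tail _ harc hz ih => exact ih.tail (hR harc) (hF hz)

theorem trans (h : WalkIn R F a b) (h' : WalkIn R F b z) : WalkIn R F a z := by
  induction h' with
  | refl => exact h
  | tail _ harc hz ih => exact ih.tail harc hz

theorem symm (h : WalkIn R F a b) : WalkIn R.inv F b a := by
  induction h with
  | refl ha => exact .refl ha
  | tail hab harc hz ih => exact (WalkIn.tail (.refl hz) harc hab.right_mem).trans ih

theorem setOf_walkIn (h : WalkIn R F a b) : WalkIn R {z | WalkIn R F a z} a b := by
  induction h with
  | refl ha => exact .refl (.refl ha)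
  | tail hab harc hz ih => exact ih.tail harc (hab.tail harc hz)

end WalkIn

/-- `Connects R F A B`: the digraph `R` has a walk from `A` to `B` all of whose vertices lie in `F`.
Thus `Z` separates `A` from `B` if and only if `¬ Connects R Zᶜ A B`. -/
def Connects (R : SetRel X X) (F A B : Set X) : Prop :=
  ∃ a ∈ A, ∃ b ∈ B, WalkIn R F a b

namespace Connects

theorem mono (hR : R ⊆ R') (hF : F ⊆ F') (h : Connects R F A B) : Connects R' F' A B := by
  obtain ⟨a, ha, b, hb, hab⟩ := h
  exact ⟨a, ha, b, hb, hab.mono hR hF⟩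

theorem symm (h : Connects R F A B) : Connects R.inv F B A := by
  obtain ⟨a, ha, b, hb, hab⟩ := h
  exact ⟨b, hb, a, ha, hab.symm⟩

theorem append (h : Connects R F A {u}) (huv : u = v ∨ (u, v) ∈ R) (h' : Connects R F {v} B) :
    Connects R F A B := by
  obtain ⟨a, ha, _, rfl, hau⟩ := h
  obtain ⟨_, rfl, b, hb, hvb⟩ := h'
  refine ⟨a, ha, b, hb, WalkIn.trans ?_ hvb⟩
  obtain rfl | harc := huv
  · exact hau
  · exact hau.tail harc hvb.left_mem

end Connects

theorem connects_inv : Connects R.inv F B A ↔ Connects R F A B :=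
  ⟨Connects.symm, Connects.symm⟩

theorem inv_insert_arc (R : SetRel X X) (x y : X) :
    (insert (x, y) R : SetRel X X).inv = insert (y, x) R.inv := by
  ext ⟨u, v⟩
  simp only [SetRel.mem_inv, Set.mem_insert_iff, Prod.mk.injEq, and_comm]

/-- `H` is the vertex set of a walk from `A` to `p` that meets `P` in `p` only. Instead of the order
of the vertices along the walk, only its consequence `connects_of_mem` is recorded. -/
structure IsApproach (R : SetRel X X) (A P : Set X) (p : X) (H : Set X) : Prop where
  connects : Connects R H A {p}
  eq_of_mem : ∀ z ∈ H, z ∈ P → z = p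
  connects_of_mem : ∀ z ∈ H, Connects R (insert z Pᶜ) A {z}

namespace IsApproach

theorem mem (h : IsApproach R A P p H) : p ∈ H := by
  obtain ⟨_, -, _, rfl, hap⟩ := h.connects
  exact hap.right_mem

theorem singleton (hA : p ∈ A) : IsApproach R A P p {p} where
  connects := ⟨p, hA, p, rfl, .refl rfl⟩
  eq_of_mem _ hz _ := hz
  connects_of_mem := by
    rintro _ rfl
    exact ⟨_, hA, _, rfl, .refl (Set.mem_insert _ _)⟩

theorem insert_setOf_walkIn (ha : a ∈ A) (hab : WalkIn R (F \ P) a b) (harc : (b, p) ∈ R) :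
    IsApproach R A P p (insert p {z | WalkIn R (F \ P) a z}) where
  connects := ⟨a, ha, p, rfl,
    (hab.setOf_walkIn.mono subset_rfl (Set.subset_insert _ _)).tail harc (Set.mem_insert _ _)⟩
  eq_of_mem z hz hzP := hz.resolve_right fun haz => haz.right_mem.2 hzP
  connects_of_mem := by
    have havoid : F \ P ⊆ Pᶜ := fun _ hz => hz.2
    rintro z (rfl | haz)
    · exact ⟨a, ha, z, rfl, (hab.mono subset_rfl (havoid.trans (Set.subset_insert _ _))).tail harc
        (Set.mem_insert _ _)⟩
    · exact ⟨a, ha, z, rfl, haz.mono subset_rfl (havoid.trans (Set.subset_insert _ _))⟩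

theorem connects_compl (h : IsApproach R A P p H) (hZ : Z ⊆ P) (hzH : z ∈ H) (hzZ : z ∉ Z) :
    Connects R Zᶜ A {z} :=
  (h.connects_of_mem z hzH).mono subset_rfl
    (Set.insert_subset hzZ (Set.compl_subset_compl.2 hZ))

theorem inter_subset (hH : IsApproach R A P p H) (hK : IsApproach R.inv B Q q K)
    (hP : Z ⊆ P) (hQ : Z ⊆ Q) (hZ : ¬ Connects R Zᶜ A B) : H ∩ K ⊆ Z := by
  rintro z ⟨hzH, hzK⟩
  by_contra hz
  exact hZ ((hH.connects_compl hP hzH hz).append (.inl rfl) (hK.connects_compl hQ hzK hz).symm)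

end IsApproach

theorem WalkIn.diff_or_exists_isApproach (ha : a ∈ A) (h : WalkIn R F a b) :
    WalkIn R (F \ P) a b ∨ ∃ p ∈ P, ∃ H ⊆ F, IsApproach R A P p H := by
  induction h with
  | refl haF =>
    by_cases haP : a ∈ P
    · exact .inr ⟨a, haP, {a}, Set.singleton_subset_iff.2 haF, .singleton ha⟩
    · exact .inl (.refl ⟨haF, haP⟩)
  | @tail b z _ harc hz ih =>
    refine ih.elim (fun hab => ?_) .inr
    by_cases hzP : z ∈ P
    · exact .inr ⟨z, hzP, _, Set.insert_subset hz fun _ haw => haw.right_mem.1,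
        .insert_setOf_walkIn ha hab harc⟩
    · exact .inl (hab.tail harc ⟨hz, hzP⟩)

theorem Connects.exists_isApproach (h : Connects R F A P) :
    ∃ p ∈ P, ∃ H ⊆ F, IsApproach R A P p H := by
  obtain ⟨a, ha, b, hb, hab⟩ := h
  exact (hab.diff_or_exists_isApproach ha).resolve_left fun h => h.right_mem.2 hb

/-- There are `n` vertex-disjoint walks from `A` to `B` in the digraph `R`, each given by a set of
vertices that contains it. -/
def Linked (R : SetRel X X) (n : ℕ) (A B : Set X) : Prop :=
  ∃ F : Fin n → Set X, Pairwise (Disjoint on F) ∧ ∀ i, Connects R (F i) A B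

namespace Linked

theorem mono (hR : R ⊆ R') (h : Linked R n A B) : Linked R' n A B := by
  obtain ⟨F, hF, hAB⟩ := h
  exact ⟨F, hF, fun i => (hAB i).mono hR subset_rfl⟩

theorem symm (h : Linked R n A B) : Linked R.inv n B A := by
  obtain ⟨F, hF, hAB⟩ := h
  exact ⟨F, hF, fun i => (hAB i).symm⟩

theorem of_le_encard_inter (h : n ≤ (A ∩ B).encard) : Linked R n A B := by
  obtain ⟨C, hC, hCn⟩ := Set.exists_subset_encard_eq h
  have : Finite C := Set.finite_of_encard_eq_coe hCn
  have hcard : Nat.card C = n := by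
    rw [Nat.card_coe_set_eq, Set.ncard, hCn, ENat.toNat_natCast]
  let f := (Finite.equivFinOfCardEq hcard).symm
  refine ⟨fun i => {(f i : X)}, fun i j hij => ?_, fun i => ?_⟩
  · exact Set.disjoint_singleton.2 (Subtype.val_injective.ne (f.injective.ne hij))
  · exact ⟨f i, (hC (f i).2).1, f i, (hC (f i).2).2, .refl rfl⟩

theorem glue {H K : Fin n → Set X} {p q : Fin n → X} (hH : Pairwise (Disjoint on H))
    (hK : Pairwise (Disjoint on K)) (hHK : Pairwise fun i j => Disjoint (H i) (K j))
    (hA : ∀ i, Connects R (H i) A {p i}) (hB : ∀ i, Connects R (K i) {q i} B)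
    (hpq : ∀ i, p i = q i ∨ (p i, q i) ∈ R) : Linked R n A B := by
  refine ⟨fun i => H i ∪ K i, fun i j hij => ?_, fun i => ?_⟩
  · exact Set.disjoint_union_left.2 ⟨Set.disjoint_union_right.2 ⟨hH hij, hHK hij⟩,
      Set.disjoint_union_right.2 ⟨(hHK hij.symm).symm, hK hij⟩⟩
  · exact ((hA i).mono subset_rfl Set.subset_union_left).append (hpq i)
      ((hB i).mono subset_rfl Set.subset_union_right)

theorem exists_isApproach (h : Linked R n A P) (hP : P.encard = n) :
    ∃ (p : Fin n → X) (H : Fin n → Set X), Injective p ∧ Set.range p = P ∧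
      Pairwise (Disjoint on H) ∧ ∀ i, IsApproach R A P (p i) (H i) := by
  obtain ⟨F, hF, hAP⟩ := h
  choose p hpP H hHF hH using fun i => (hAP i).exists_isApproach
  have hHdisj : Pairwise (Disjoint on H) := fun i j hij => (hF hij).mono (hHF i) (hHF j)
  have hp : Injective p := fun i j hij => by
    by_contra hne
    exact Set.disjoint_left.1 (hHdisj hne) (hH i).mem (hij ▸ (hH j).mem)
  have hrange : (Set.range p).encard = n := by
    rw [← Set.image_univ, hp.encard_image, Set.encard_univ, ENat.card_eq_coe_fintype_card,
      Fintype.card_fin]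
  exact ⟨p, H, hp, (Set.finite_range p).eq_of_subset_of_encard_le (Set.range_subset_iff.2 hpP)
    (hP.trans hrange.symm).le, hHdisj, hH⟩

theorem insert_arc (hA : Linked R n A (insert x Z)) (hB : Linked R n (insert y Z) B)
    (hZ : ¬ Connects R Zᶜ A B) (hx : x ∉ Z) (hy : y ∉ Z) (hn : Z.encard + 1 = n) :
    Linked (insert (x, y) R) n A B := by
  classical
  obtain ⟨p, H, hp, hprange, hHdisj, hH⟩ :=
    hA.exists_isApproach ((Set.encard_insert_of_notMem hx).trans hn)
  obtain ⟨q, K, -, hqrange, hKdisj, hK⟩ :=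
    hB.symm.exists_isApproach ((Set.encard_insert_of_notMem hy).trans hn)
  have hpmem : ∀ i, p i ∈ insert x Z := fun i => hprange ▸ Set.mem_range_self i
  -- `Equiv.swap x y` sends each end in `Z ∪ {x}` to the start in `Z ∪ {y}` where its walk goes on.
  have hswap : ∀ z ∈ Z, Equiv.swap x y z = z := fun z hz =>
    Equiv.swap_apply_of_ne_of_ne (ne_of_mem_of_not_mem hz hx) (ne_of_mem_of_not_mem hz hy)
  have hpartner : ∀ i, ∃ j, q j = Equiv.swap x y (p i) := fun i => by
    rw [← Set.mem_range, hqrange]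
    obtain hi | hi := hpmem i
    · exact .inl (by rw [hi, Equiv.swap_apply_left])
    · exact .inr (by rwa [hswap _ hi])
  choose σ hσ using hpartner
  have hσinj : Injective σ := fun i j hij =>
    hp ((Equiv.swap x y).injective (by rw [← hσ, ← hσ, hij]))
  have hHK : Pairwise fun i j => Disjoint (H i) (K (σ j)) := by
    refine fun i j hij => Set.disjoint_left.2 fun z hzH hzK => hij (hp ?_)
    have hz : z ∈ Z := (hH i).inter_subset (hK (σ j)) (Set.subset_insert x Z)
      (Set.subset_insert y Z) hZ ⟨hzH, hzK⟩
    have hzp : z = p i := (hH i).eq_of_mem z hzH (.inr hz)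
    have hzq : z = q (σ j) := (hK (σ j)).eq_of_mem z hzK (.inr hz)
    refine (Equiv.swap x y).injective ?_
    rw [← hσ j, ← hzq, ← hzp, hswap z hz]
  have hlink : ∀ i, p i = q (σ i) ∨ (p i, q (σ i)) ∈ insert (x, y) R := fun i => by
    obtain hi | hi := hpmem i
    · exact .inr (.inl (by rw [hσ, hi, Equiv.swap_apply_left]))
    · exact .inl (by rw [hσ, hswap _ hi])
  exact glue (K := fun i => K (σ i)) hHdisj (fun i j hij => hKdisj (hσinj.ne hij)) hHK
    (fun i => (hH i).connects.mono (Set.subset_insert _ _) subset_rfl)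
    (fun i => (hK (σ i)).connects.symm.mono (Set.subset_insert _ _) subset_rfl) hlink

end Linked

theorem not_connects_insert_arc_of_insert_source (hZ : ¬ Connects R Zᶜ A B)
    (hY : ¬ Connects R Yᶜ A (insert x Z)) : ¬ Connects (insert (x, y) R) Yᶜ A B := by
  rintro ⟨a, ha, b, hb, hab⟩
  suffices h : WalkIn R (Yᶜ \ insert x Z) a b from
    hZ ⟨a, ha, b, hb, h.mono subset_rfl fun v hv hvZ => hv.2 (.inr hvZ)⟩
  clear hb
  induction hab with
  | refl haY => exact .refl ⟨haY, fun haZ => hY ⟨a, ha, a, haZ, .refl haY⟩⟩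
  | @tail u v _ harc hv ih =>
    have hux : u ≠ x := fun h => ih.right_mem.2 (.inl h)
    have huv : (u, v) ∈ R := harc.resolve_left fun h => hux (congrArg Prod.fst h)
    exact ih.tail huv
      ⟨hv, fun hvZ => hY ⟨a, ha, v, hvZ, (ih.mono subset_rfl Set.sdiff_subset).tail huv hv⟩⟩

theorem not_connects_insert_arc_of_insert_target (hZ : ¬ Connects R Zᶜ A B)
    (hY : ¬ Connects R Yᶜ (insert y Z) B) : ¬ Connects (insert (x, y) R) Yᶜ A B := by
  rw [← connects_inv] at hZ hY ⊢
  rw [inv_insert_arc]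
  exact not_connects_insert_arc_of_insert_source hZ hY

theorem not_connects_compl_left : ¬ Connects R Aᶜ A B := by
  rintro ⟨a, ha, b, -, hab⟩
  exact hab.left_mem ha

theorem not_connects_compl_right : ¬ Connects R Bᶜ A B := by
  rintro ⟨a, -, b, hb, hab⟩
  exact hab.right_mem hb

theorem Connects.inter_nonempty_of_empty (h : Connects (∅ : SetRel X X) F A B) :
    (F ∩ (A ∩ B)).Nonempty := by
  obtain ⟨a, ha, b, hb, hab⟩ := h
  cases hab with
  | refl haF => exact ⟨a, haF, ha, hb⟩
  | tail _ harc _ => exact absurd harc (Set.notMem_empty _)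

theorem linked_of_forall_le_encard (hR : R.Finite)
    (h : ∀ Z, ¬ Connects R Zᶜ A B → n ≤ Z.encard) : Linked R n A B := by
  induction R, hR using Set.Finite.induction_on generalizing A B with
  | empty =>
    refine .of_le_encard_inter (h _ fun hAB => ?_)
    obtain ⟨z, hz, hzAB⟩ := hAB.inter_nonempty_of_empty
    exact hz hzAB
  | @insert arc R _ _ ih =>
    obtain ⟨x, y⟩ := arc
    by_cases hsep : ∀ Z, ¬ Connects R Zᶜ A B → n ≤ Z.encard
    · exact (ih hsep).mono (Set.subset_insert _ _)
    push Not at hsep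
    obtain ⟨Z, hZ, hZn⟩ := hsep
    have hxZ : n ≤ (insert x Z).encard :=
      h _ (not_connects_insert_arc_of_insert_source hZ not_connects_compl_right)
    have hyZ : n ≤ (insert y Z).encard :=
      h _ (not_connects_insert_arc_of_insert_target hZ not_connects_compl_left)
    have hnotMem : ∀ w, n ≤ (insert w Z).encard → w ∉ Z := fun w hw hwZ =>
      hZn.not_ge (by rwa [Set.insert_eq_of_mem hwZ] at hw)
    have hx : x ∉ Z := hnotMem x hxZ
    have hn : Z.encard + 1 = n :=
      (Order.add_one_le_of_lt hZn).antisymm (by rwa [Set.encard_insert_of_notMem hx] at hxZ)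
    exact .insert_arc (ih fun Y hY => h Y (not_connects_insert_arc_of_insert_source hZ hY))
      (ih fun Y hY => h Y (not_connects_insert_arc_of_insert_target hZ hY)) hZ hx (hnotMem y hyZ) hn

end Menger

/-! ### Edge-disjoint walks from the inputs to the outputs -/

section Edges

variable {α β : Type*}

/-- Adjacency of edges: two edges are adjacent if they share a vertex. Walks for this relation are
the walks in the line graph of `G`. -/
def edgeAdj (G : Graph α β) : SetRel G.edgeSet G.edgeSet :=
  {e | ∃ v, G.Inc e.1 v ∧ G.Inc e.2 v}

/-- The edges that are incident to a vertex in `U`. -/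
def edgesAt (G : Graph α β) (U : Set α) : Set G.edgeSet :=
  {e | ∃ u ∈ U, G.Inc e u}

end Edges

namespace OpenGraph

variable {α β : Type*} {N : OpenGraph α β}

theorem minCut_le_ncard {C : Set β} (hC : N.IsEdgeCut C) : N.minCut ≤ C.ncard :=
  Nat.sInf_le ⟨C, hC, rfl⟩

theorem isEdgeCut_setOf_isLink {A : Set α} (hA : A ⊆ N.graph.vertexSet) (hS : N.S ⊆ A)
    (hT : Disjoint N.T A) :
    N.IsEdgeCut {e | ∃ u ∈ A, ∃ v ∈ N.graph.vertexSet \ A, N.graph.IsLink e u v} :=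
  ⟨A, N.graph.vertexSet \ A, Set.union_sdiff_cancel hA, Set.disjoint_sdiff_right, hS,
    Set.subset_sdiff.2 ⟨N.subset_right, hT⟩, rfl⟩

variable (N) in
/-- The input side of the cut defined by a set `Z` of edges: the inputs and the ends of the edges
that can be reached from the inputs without using `Z`. -/
def inputSide (Z : Set N.graph.edgeSet) : Set α :=
  N.S ∪ {v | ∃ e : N.graph.edgeSet, N.graph.Inc e v ∧
    Connects (edgeAdj N.graph) Zᶜ (edgesAt N.graph N.S) {e}}

theorem inputSide_subset (Z : Set N.graph.edgeSet) : N.inputSide Z ⊆ N.graph.vertexSet :=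
  Set.union_subset N.subset_left fun _ ⟨_, hev, _⟩ => hev.vertex_mem

theorem disjoint_inputSide {Z : Set N.graph.edgeSet}
    (hZ : ¬ Connects (edgeAdj N.graph) Zᶜ (edgesAt N.graph N.S) (edgesAt N.graph N.T)) :
    Disjoint N.T (N.inputSide Z) := by
  refine Set.disjoint_union_right.2 ⟨N.disjoint.symm, Set.disjoint_left.2 ?_⟩
  rintro t ht ⟨e, het, a, ha, _, rfl, hae⟩
  exact hZ ⟨a, ha, _, ⟨t, ht, het⟩, hae⟩

theorem mem_inputSide_of_isLink {Z : Set N.graph.edgeSet} {e : N.graph.edgeSet} {u v : α}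
    (heZ : e ∉ Z) (huv : N.graph.IsLink e u v) (hu : u ∈ N.inputSide Z) : v ∈ N.inputSide Z := by
  refine .inr ⟨e, huv.inc_right, ?_⟩
  obtain hu | ⟨e', he'u, a, ha, _, rfl, hae'⟩ := hu
  · exact ⟨e, ⟨u, hu, huv.inc_left⟩, e, rfl, .refl heZ⟩
  · exact ⟨a, ha, e, rfl, hae'.tail ⟨u, he'u, huv.inc_left⟩ heZ⟩

theorem minCut_le_encard {Z : Set N.graph.edgeSet}
    (hZ : ¬ Connects (edgeAdj N.graph) Zᶜ (edgesAt N.graph N.S) (edgesAt N.graph N.T)) :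
    N.minCut ≤ Z.encard := by
  have hcut := isEdgeCut_setOf_isLink (inputSide_subset Z) Set.subset_union_left
    (disjoint_inputSide hZ)
  rw [← Z.toFinite.cast_ncard_eq, Nat.cast_le,
    ← Set.ncard_image_of_injective Z Subtype.val_injective]
  refine (minCut_le_ncard hcut).trans (Set.ncard_le_ncard ?_ (Set.toFinite _))
  rintro e ⟨u, hu, v, hv, huv⟩
  by_contra he
  have heZ : (⟨e, huv.edge_mem⟩ : N.graph.edgeSet) ∉ Z := fun h => he ⟨_, h, rfl⟩
  exact hv.2 (mem_inputSide_of_isLink heZ huv hu)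

variable (N) in
theorem linked_minCut :
    Linked (edgeAdj N.graph) N.minCut (edgesAt N.graph N.S) (edgesAt N.graph N.T) :=
  linked_of_forall_le_encard (Set.toFinite _) fun _ => minCut_le_encard

end OpenGraph

/-! ### Tensors that accept a family of multi-indices -/

theorem card_le_rank_of_submatrix_diagonal {ι m n 𝕜 : Type*} [Fintype ι] [Fintype n]
    [Field 𝕜] (M : Matrix m n 𝕜) (f : ι → m) (g : ι → n) (hdiag : ∀ i, M (f i) (g i) ≠ 0)
    (hoff : ∀ i j, i ≠ j → M (f i) (g j) = 0) : Fintype.card ι ≤ M.rank := by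
  classical
  have hsub : M.submatrix f g = Matrix.diagonal fun i => M (f i) (g i) := by
    ext i j
    obtain rfl | hij := eq_or_ne i j
    · rw [Matrix.submatrix_apply, Matrix.diagonal_apply_eq]
    · rw [Matrix.submatrix_apply, Matrix.diagonal_apply_ne _ hij, hoff i j hij]
  calc Fintype.card ι = (M.submatrix f g).rank := by
        rw [hsub, Matrix.rank_diagonal]
        simp [hdiag]
    _ ≤ M.rank := Matrix.rank_submatrix_le _ _ _

namespace OpenGraph

variable {α β ι : Type*} {N : OpenGraph α β} {c : β → ℕ}

theorem rank_beta_le_quantumMaxFlow (𝒯 : N.TensorAssignment c) :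
    (N.beta 𝒯).rank ≤ N.quantumMaxFlow c :=
  le_csSup ⟨Fintype.card (N.InputIndex c), by
    rintro _ ⟨𝒯, rfl⟩
    exact (N.beta 𝒯).rank_le_card_width⟩ ⟨𝒯, rfl⟩

open Classical in
/-- The tensor assignment that accepts, at each vertex, exactly what can be read there from some
member of the family `w` of multi-indices. -/
noncomputable def indicatorTensor (w : ι → N.EdgeIndex c) : N.TensorAssignment c := fun v I =>
  if ∃ i, I = readAt (w i) v then 1 else 0

theorem beta_indicatorTensor_ne_zero_iff {w : ι → N.EdgeIndex c} {J : N.OutputIndex c}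
    {I : N.InputIndex c} : N.beta (indicatorTensor w) J I ≠ 0 ↔
      ∃ W : N.EdgeIndex c, (∀ u : N.S, readAt W (u : α) = I u) ∧
        (∀ u : N.T, readAt W (u : α) = J u) ∧
          ∀ v : N.internal, ∃ i, readAt W (v : α) = readAt (w i) v := by
  simp only [beta, indicatorTensor, Finset.prod_ite_zero, Finset.prod_const_one, Finset.mem_univ,
    true_imp_iff, Finset.sum_boole, Finset.filter_filter, Nat.cast_ne_zero, Finset.card_ne_zero,
    Finset.Nonempty, Finset.mem_filter, true_and, and_assoc]

theorem card_le_quantumMaxFlow [Fintype ι] (w : ι → N.EdgeIndex c)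
    (hw : ∀ (i j : ι) (W : N.EdgeIndex c), (∀ u : N.S, readAt W (u : α) = readAt (w i) u) →
      (∀ u : N.T, readAt W (u : α) = readAt (w j) u) →
      (∀ v : N.internal, ∃ k, readAt W (v : α) = readAt (w k) v) → i = j) :
    Fintype.card ι ≤ N.quantumMaxFlow c := by
  refine (card_le_rank_of_submatrix_diagonal (N.beta (indicatorTensor w))
    (fun j u => readAt (w j) u) (fun i u => readAt (w i) u) (fun i => ?_)
    fun j i hji => ?_).trans (rank_beta_le_quantumMaxFlow _)
  · exact beta_indicatorTensor_ne_zero_iff.2 ⟨w i, fun _ => rfl, fun _ => rfl, fun _ => ⟨i, rfl⟩⟩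
  · by_contra hne
    obtain ⟨W, hS, hT, hV⟩ := beta_indicatorTensor_ne_zero_iff.1 hne
    exact hji (hw i j W hS hT hV).symm

/-! ### Labellings of disjoint walks -/

open Function in
theorem exists_edgeIndex_eq_on (hc : ∀ e ∈ N.graph.edgeSet, 0 < c e)
    {F : ι → Set N.graph.edgeSet} (hF : Pairwise (Disjoint on F)) (x : ι → ℕ)
    (hx : ∀ i, ∀ e ∈ F i, x i < c e) :
    ∃ W : N.EdgeIndex c, ∀ i, ∀ e ∈ F i, (W e : ℕ) = x i := by
  have hlocal : ∀ e : N.graph.edgeSet, ∃ m : Fin (c e), ∀ i, e ∈ F i → (m : ℕ) = x i := by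
    intro e
    by_cases he : ∃ i, e ∈ F i
    · obtain ⟨i, hi⟩ := he
      refine ⟨⟨x i, hx i e hi⟩, fun j hj => congrArg x ?_⟩
      by_contra hij
      exact Set.disjoint_left.1 (hF hij) hi hj
    · exact ⟨⟨0, hc e e.2⟩, fun i hi => absurd ⟨i, hi⟩ he⟩
  choose W hW using hlocal
  exact ⟨W, fun i e he => hW e i he⟩

theorem eq_of_readAt_eq {W W' : N.EdgeIndex c} {v : α} (h : readAt W v = readAt W' v)
    {e : N.graph.edgeSet} (he : N.graph.Inc e v) : W e = W' e :=
  congrFun h (.inl ⟨e, he⟩)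

theorem val_eq_val_of_walkIn {F : Set N.graph.edgeSet} {W : N.EdgeIndex c}
    (hW : ∀ v ∈ N.graph.vertexSet, ∃ W' : N.EdgeIndex c, readAt W v = readAt W' v ∧
      ∀ e ∈ F, ∀ e' ∈ F, (W' e : ℕ) = W' e')
    {a b : N.graph.edgeSet} (hab : WalkIn (edgeAdj N.graph) F a b) : (W a : ℕ) = W b := by
  induction hab with
  | refl => rfl
  | @tail e e' hae hadj he' ih =>
    obtain ⟨v, hev, he'v⟩ := hadj
    obtain ⟨W', hWW', hconst⟩ := hW v hev.vertex_mem
    rw [ih, eq_of_readAt_eq hWW' hev, eq_of_readAt_eq hWW' he'v, hconst e hae.right_mem e' he']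

theorem label_eq_of_connects {F : Set N.graph.edgeSet}
    (hF : Connects (edgeAdj N.graph) F (edgesAt N.graph N.S) (edgesAt N.graph N.T))
    {w : ι → N.EdgeIndex c} {x : ι → ℕ} (hw : ∀ i, ∀ e ∈ F, (w i e : ℕ) = x i)
    {i j : ι} {W : N.EdgeIndex c} (hS : ∀ u : N.S, readAt W (u : α) = readAt (w i) u)
    (hT : ∀ u : N.T, readAt W (u : α) = readAt (w j) u)
    (hV : ∀ v : N.internal, ∃ k, readAt W (v : α) = readAt (w k) v) : x i = x j := by
  obtain ⟨a, ⟨s, hs, has⟩, b, ⟨t, ht, hbt⟩, hab⟩ := hF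
  have hlocal : ∀ v ∈ N.graph.vertexSet, ∃ k, readAt W v = readAt (w k) v := by
    intro v hv
    by_cases hvS : v ∈ N.S
    · exact ⟨i, hS ⟨v, hvS⟩⟩
    by_cases hvT : v ∈ N.T
    · exact ⟨j, hT ⟨v, hvT⟩⟩
    · exact hV ⟨v, hv, fun h => h.elim hvS hvT⟩
  calc x i = W a := by rw [eq_of_readAt_eq (hS ⟨s, hs⟩) has, hw i a hab.left_mem]
    _ = W b := by
        refine val_eq_val_of_walkIn (fun v hv => ?_) hab
        obtain ⟨k, hk⟩ := hlocal v hv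
        exact ⟨w k, hk, fun e he e' he' => (hw k e he).trans (hw k e' he').symm⟩
    _ = x j := by rw [eq_of_readAt_eq (hT ⟨t, ht⟩) hbt, hw j b hab.right_mem]

end OpenGraph

theorem proposition3p10 {α β : Type*} (N : OpenGraph α β) (c : β → ℕ)
    (hc : ∀ e ∈ N.graph.edgeSet, 0 < c e)
    (dmin : ℕ) (hd : ∀ e ∈ N.graph.edgeSet, dmin ≤ c e) :
    dmin ^ N.minCut ≤ N.quantumMaxFlow c := by
  obtain ⟨F, hF, hconn⟩ := N.linked_minCut
  choose w hw using fun x : Fin N.minCut → Fin dmin =>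
    OpenGraph.exists_edgeIndex_eq_on hc hF (fun i => (x i : ℕ))
      fun i e _ => (x i).isLt.trans_le (hd e e.2)
  calc dmin ^ N.minCut = Fintype.card (Fin N.minCut → Fin dmin) := by simp
    _ ≤ N.quantumMaxFlow c :=
      OpenGraph.card_le_quantumMaxFlow w fun x y W hS hT hV => funext fun i => Fin.ext <|
        OpenGraph.label_eq_of_connects (hconn i) (fun x => hw x i) hS hT hV
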